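/- Consider a finite set $V$ of nodes with an undirected interference graph $G=(V,E)$. Packets arrive at node $i$ as a Poisson process of rate $\lambda_i>0$, transmission times at node $i$ are exponential with mean $1/\mu_i$, and back-off times at node $i$ are exponential with mean $1/\nu_i$; everything is independent. A node is unblocked when neither it nor any of its neighbours is active, and back-off periods run only while the node is unblocked. When a back-off period of node $i$ ends with $n$ packets at the node, the node becomes active with probability $\phi_i(n)\in[0,1]$ and otherwise begins another back-off period. When a transmission of node $i$ ends and leaves $n$ packets behind, the node releases the medium with probability $\psi_i(n)\in[0,1]$ and otherwise starts the next transmission (of a dummy packet if $n=0$). Let $U_i(t)\in\{0,1\}$ be the activity of node $i$ and $L_i(t)$ the number of packets at node $i$, including any packet in transmission. Then $(U(t),L(t))$ is a Markov process in which an unblocked node $i$ activates at rate $f_i(L_i(t))$, $f_i(n)=\nu_i\phi_i(n)$, and an active node $i$ de-activates at rate $g_i(L_i(t))$, $g_i(n)=\mu_i\psi_i(\max(n-1,0))$. Put $\rho_i=\lambda_i/\mu_i$ and $\rho_C=\sum_{j\in C}\rho_j$. Assume that the system is stable, i.e. that $(U(t),L(t))$ is positive recurrent (transient states are allowed outside the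 recurrent class, which is reached with probability one from every state). Then it has a stationary distribution. Let $(U,L)$ have a stationary distribution, let $C\subseteq V$ be a clique of $G$ containing node $i$, and let $L_{i,C}$ be the number of packets at node $i$ at an arbitrary epoch at which no node of $C$ is active, that is, $L_i$ conditioned on $U_j=0$ for all $j\in C$. Then $\rho_C<1$ and, provided $\mathbb E[g_i(L_i+1)]>0$, the event $\{U_j=0\ \forall j\in C\}$ has positive probability and $$\frac{\mathbb E[f_i(L_{i,C})]}{\mathbb E[g_i(L_i+1)]}\ \ge\ \frac{\rho_i}{1-\rho_C},\qquad\text{where } g_i(L_i+1)=\mu_i\psi_i(L_i).$$ In particular, if $\phi_i(\cdot)\equiv\phi_i$ and $\psi_i(\cdot)\equiv\psi_i>0$ are constant (fixed rates), then $\sigma_i:=\dfrac{\nu_i\phi_i}{\mu_i\psi_i}\ge\dfrac{\rho_i}{1-\rho_C}$. -/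

import Mathlib

open MeasureTheory

/-- The parameters of a random-access network with node set `V`: the interference graph, the
Poisson arrival rates `arr i`, the transmission rates `mu i` (mean transmission time `1 / mu i`),
the back-off rates `nu i` (mean back-off time `1 / nu i`), the probabilities `phi i n` of starting
a transmission when a back-off period of node `i` ends with `n` packets at the node, and the
probabilities `psi i n` of releasing the medium when a transmission of node `i` ends and leaves
`n` packets behind. -/
structure Network (V : Type*) where
  graph : SimpleGraph V
  arr : V → ℝ
  mu : V → ℝ
  nu : V → ℝ
  phi : V → ℕ → ℝ
  psi : V → ℕ → ℝ
  arr_pos : ∀ i, 0 < arr i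
  mu_pos : ∀ i, 0 < mu i
  nu_pos : ∀ i, 0 < nu i
  phi_nonneg : ∀ i n, 0 ≤ phi i n
  phi_le_one : ∀ i n, phi i n ≤ 1
  psi_nonneg : ∀ i n, 0 ≤ psi i n
  psi_le_one : ∀ i n, psi i n ≤ 1

namespace Network

variable {V : Type*}

/-- Activation function: the rate at which node `i` activates when it is unblocked and holds
`n` packets. -/
def f (N : Network V) (i : V) (n : ℕ) : ℝ := N.nu i * N.phi i n

/-- De-activation function: the rate at which node `i` de-activates when it is active and holds
`n` packets, the one in transmission included. A transmission that ends leaves `n - 1` packets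
behind if `n > 0`, and none if `n = 0` (a dummy packet), which is truncated subtraction. -/
def g (N : Network V) (i : V) (n : ℕ) : ℝ := N.mu i * N.psi i (n - 1)

/-- Traffic intensity of a node. -/
noncomputable def rho (N : Network V) (i : V) : ℝ := N.arr i / N.mu i

/-- Aggregate traffic intensity of a set of nodes. -/
noncomputable def load (N : Network V) (C : Finset V) : ℝ := ∑ j ∈ C, N.rho j

/-- Joint state of the network: the set of active nodes, which is an independent set of the
interference graph, and the number of packets at every node. -/
@[ext]
structure State (N : Network V) where
  active : Finset V
  feasible : N.graph.IsIndepSet (active : Set V)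
  queue : V → ℕ

instance (N : Network V) : MeasurableSpace N.State := ⊤

/-- Node `i` is unblocked: neither the node nor any of its neighbours is active. -/
def Unblocked (N : Network V) (x : N.State) (i : V) : Prop :=
  i ∉ x.active ∧ ∀ j, N.graph.Adj i j → j ∉ x.active

section Dynamics

variable [Fintype V] [DecidableEq V]

open Classical in
/-- Transition rates of the Markov process (off the diagonal). For every node `i`, the four terms
are: arrival of a packet, activation, transmission completion followed back-to-back by another
transmission, transmission completion followed by a back-off period. -/
noncomputable def rate (N : Network V) (x y : N.State) : ℝ :=
  if x = y then 0 else
    ∑ i, ((if y.active = x.active ∧ y.queue = Function.update x.queue i (x.queue i + 1)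
            then N.arr i else 0)
        + (if N.Unblocked x i ∧ y.active = insert i x.active ∧ y.queue = x.queue
            then N.f i (x.queue i) else 0)
        + (if i ∈ x.active ∧ y.active = x.active ∧
              y.queue = Function.update x.queue i (x.queue i - 1)
            then N.mu i - N.g i (x.queue i) else 0)
        + (if i ∈ x.active ∧ y.active = x.active.erase i ∧
              y.queue = Function.update x.queue i (x.queue i - 1)
            then N.g i (x.queue i) else 0))

/-- Total rate out of a state. The mean holding time is its inverse. -/
noncomputable def exitRate (N : Network V) (x : N.State) : ENNReal :=
  ∑' y, ENNReal.ofReal (N.rate x y)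

/-- Transition probabilities of the embedded jump chain. -/
noncomputable def jumpProb (N : Network V) (x y : N.State) : ENNReal :=
  ENNReal.ofReal (N.rate x y) / N.exitRate x

open Classical in
/-- `avoid z x n y` is the probability that the jump chain started in `x` is in `y` after `n`
jumps and has not been in `z` after any of the jumps `1, …, n`. -/
noncomputable def avoid (N : Network V) (z x : N.State) : ℕ → N.State → ENNReal
  | 0, y => if y = x then 1 else 0
  | n + 1, y => if y = z then 0 else ∑' w, avoid N z x n w * N.jumpProb w y

/-- Probability that the process started in `x` enters `z` after one or more jumps. -/
noncomputable def hitProb (N : Network V) (z x : N.State) : ENNReal :=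
  ∑' n, ∑' y, N.avoid z x n y * N.jumpProb y z

/-- Expected time until the process started in `z` is back in `z` after leaving it: the sum
of the mean holding times of the states visited before the return. -/
noncomputable def meanReturnTime (N : Network V) (z : N.State) : ENNReal :=
  ∑' n, ∑' y, N.avoid z z n y * (N.exitRate y)⁻¹

/-- Stability, that is, positive recurrence of the process: there is a state that is reached from
every state (itself included) with probability one and that has a finite mean return time. States
that cannot be re-entered, such as an active node with an empty buffer in a system without dummy
packets, may be transient. -/
def IsStable (N : Network V) : Prop :=
  ∃ z, (∀ x, N.hitProb z x = 1) ∧ N.meanReturnTime z ≠ ⊤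

/-- `π` is a stationary distribution of the process (global balance equations). -/
def IsStationary (N : Network V) (π : PMF N.State) : Prop :=
  ∀ y, ∑' x, π x * ENNReal.ofReal (N.rate x y) = π y * N.exitRate y

end Dynamics

/-- The non-serving states for a set of nodes: none of the nodes in it is active. -/
def idle (N : Network V) (C : Finset V) : Set N.State := {x | ∀ j ∈ C, j ∉ x.active}

/-- `E[F(L_i)]` in steady state, where `L_i` is the number of packets at node `i`. -/
noncomputable def expQueue (N : Network V) (π : PMF N.State) (i : V) (F : ℕ → ℝ) : ℝ :=
  ∫ x, F (x.queue i) ∂π.toMeasure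

/-- `E[F(L_{i,C})]` in steady state, where `L_{i,C}` is the number of packets at node `i` at an
arbitrary epoch during a non-serving interval for `C`. -/
noncomputable def expQueueIdle (N : Network V) (π : PMF N.State) (i : V) (C : Finset V)
    (F : ℕ → ℝ) : ℝ :=
  ∫ x, F (x.queue i) ∂(ProbabilityTheory.cond π.toMeasure (N.idle C))

end Network

open scoped ENNReal

set_option linter.unusedSectionVars false

namespace Network

variable {V : Type*}

/-! In steady state the flow out of any set of states equals the flow into it (`IsStationary.cut`).
Two cuts suffice. The cut at queue length `n` gives λ_i P(L_i = n) = μ_i P(L_i = n + 1, U_i = 1)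
(`IsStationary.level_crossing`). Summation yields ρ_i = P(L_i ≠ 0, U_i = 1), and, with weight g_i,
λ_i E[g_i(L_i + 1)] ≤ μ_i E[g_i(L_i); U_i = 1]; the loss comes from dummy packets. The cut at the
activity of i gives E[f_i(L_i); i unblocked] = E[g_i(L_i); U_i = 1]
(`IsStationary.lintegral_activation`). An unblocked node of a clique C sees all of C idle, so ρ_i
E[g_i(L_i + 1)] ≤ E[f_i(L_i); C idle]. At most one node of C is active at a time, so genuine
transmissions in C occupy a fraction ρ_C of time and P(C idle) ≤ 1 - ρ_C. Dividing gives the bound.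
Existence of a stationary distribution follows from the cycle formula of renewal theory. -/

instance instCountableState [Finite V] (N : Network V) : Countable N.State := by
  have : Function.Injective (fun x : N.State => (x.active, x.queue)) := fun x y h => by
    simp only [Prod.mk.injEq] at h
    exact State.ext h.1 h.2
  exact this.countable

instance instDiscreteState (N : Network V) : DiscreteMeasurableSpace N.State :=
  ⟨fun _ => trivial⟩

lemma f_nonneg (N : Network V) (i : V) (n : ℕ) : 0 ≤ N.f i n :=
  mul_nonneg (N.nu_pos i).le (N.phi_nonneg i n)

lemma g_nonneg (N : Network V) (i : V) (n : ℕ) : 0 ≤ N.g i n :=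
  mul_nonneg (N.mu_pos i).le (N.psi_nonneg i _)

lemma f_le (N : Network V) (i : V) (n : ℕ) : N.f i n ≤ N.nu i :=
  mul_le_of_le_one_right (N.nu_pos i).le (N.phi_le_one i n)

lemma g_le (N : Network V) (i : V) (n : ℕ) : N.g i n ≤ N.mu i :=
  mul_le_of_le_one_right (N.mu_pos i).le (N.psi_le_one i _)

lemma rho_pos (N : Network V) (i : V) : 0 < N.rho i := div_pos (N.arr_pos i) (N.mu_pos i)

/-! ### Moves of the process and boundedness of its rates. -/

section Dynamics

variable [Fintype V] [DecidableEq V] (N : Network V)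

/-- The state after an arrival at node `i`. -/
def arrive (x : N.State) (i : V) : N.State :=
  ⟨x.active, x.feasible, Function.update x.queue i (x.queue i + 1)⟩

open Classical in
/-- The state after an activation of node `i`; a blocked node does not activate. -/
noncomputable def activate (x : N.State) (i : V) : N.State :=
  if h : N.Unblocked x i then
    ⟨insert i x.active, by
      rw [Finset.coe_insert, SimpleGraph.isIndepSet_iff, Set.pairwise_insert]
      exact ⟨x.feasible, fun j hj _ =>
        ⟨fun hadj => h.2 j hadj hj, fun hadj => h.2 j hadj.symm hj⟩⟩, x.queue⟩
  else x

/-- The state after a completed transmission of node `i` that is followed by another one. -/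
def continueServing (x : N.State) (i : V) : N.State :=
  ⟨x.active, x.feasible, Function.update x.queue i (x.queue i - 1)⟩

/-- The state after a completed transmission of node `i` that is followed by a back-off period. -/
def release (x : N.State) (i : V) : N.State :=
  ⟨x.active.erase i, by
    rw [Finset.coe_erase]
    exact x.feasible.mono Set.sdiff_subset, Function.update x.queue i (x.queue i - 1)⟩

open Classical in
-- Each term becomes an indicator of one target state, so that sums over `y` collapse. The diagonal
-- is excluded because a blocked activation or a dummy transmission followed by another leads back
-- to `x`.
lemma ofReal_rate {x y : N.State} (h : x ≠ y) :
    ENNReal.ofReal (N.rate x y) = ∑ i,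
      ((if y = N.arrive x i then ENNReal.ofReal (N.arr i) else 0)
      + (if y = N.activate x i then
          if N.Unblocked x i then ENNReal.ofReal (N.f i (x.queue i)) else 0 else 0)
      + (if y = N.continueServing x i then
          if i ∈ x.active then ENNReal.ofReal (N.mu i - N.g i (x.queue i)) else 0 else 0)
      + (if y = N.release x i then
          if i ∈ x.active then ENNReal.ofReal (N.g i (x.queue i)) else 0 else 0)) := by
  have hmg : ∀ i, 0 ≤ N.mu i - N.g i (x.queue i) := fun i => sub_nonneg.2 (N.g_le i _)
  have ite_nonneg' : ∀ (p : Prop) [Decidable p] (r : ℝ), 0 ≤ r → 0 ≤ if p then r else 0 := fun p _ r hr => by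
    split_ifs <;> simp [hr]
  have h1 : ∀ i, (0 : ℝ) ≤ if y.active = x.active ∧
      y.queue = Function.update x.queue i (x.queue i + 1) then N.arr i else 0 :=
    fun i => ite_nonneg' _ _ (N.arr_pos i).le
  have h2 : ∀ i, (0 : ℝ) ≤ if N.Unblocked x i ∧ y.active = insert i x.active ∧
      y.queue = x.queue then N.f i (x.queue i) else 0 :=
    fun i => ite_nonneg' _ _ (N.f_nonneg i _)
  have h3 : ∀ i, (0 : ℝ) ≤ if i ∈ x.active ∧ y.active = x.active ∧
      y.queue = Function.update x.queue i (x.queue i - 1)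
      then N.mu i - N.g i (x.queue i) else 0 :=
    fun i => ite_nonneg' _ _ (hmg i)
  have h4 : ∀ i, (0 : ℝ) ≤ if i ∈ x.active ∧ y.active = x.active.erase i ∧
      y.queue = Function.update x.queue i (x.queue i - 1) then N.g i (x.queue i) else 0 :=
    fun i => ite_nonneg' _ _ (N.g_nonneg i _)
  have ofReal_ite : ∀ (p : Prop) [Decidable p] (r : ℝ),
      ENNReal.ofReal (if p then r else 0) = if p then ENNReal.ofReal r else 0 := fun p _ r => by
    split_ifs <;> simp
  rw [rate, if_neg h, ENNReal.ofReal_sum_of_nonneg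
    fun i _ => add_nonneg (add_nonneg (add_nonneg (h1 i) (h2 i)) (h3 i)) (h4 i)]
  refine Finset.sum_congr rfl fun i _ => ?_
  rw [ENNReal.ofReal_add (add_nonneg (add_nonneg (h1 i) (h2 i)) (h3 i)) (h4 i),
    ENNReal.ofReal_add (add_nonneg (h1 i) (h2 i)) (h3 i), ENNReal.ofReal_add (h1 i) (h2 i)]
  simp only [ofReal_ite, ← ite_and]
  congr 1
  · congr 1
    · congr 1
      · simp [State.ext_iff, arrive]
      · by_cases hu : N.Unblocked x i <;> simp [State.ext_iff, activate, hu]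
    · simp [State.ext_iff, continueServing, and_comm]
  · simp [State.ext_iff, release, and_comm]

open Classical in
/-- The rate at which the process jumps from `x`, weighted by a function of the new state that
vanishes at `x`, as a sum over the possible moves. -/
lemma tsum_rate_mul (x : N.State) (h : N.State → ℝ≥0∞) (hx : h x = 0) :
    ∑' y, ENNReal.ofReal (N.rate x y) * h y = ∑ i,
      (ENNReal.ofReal (N.arr i) * h (N.arrive x i)
      + (if N.Unblocked x i then ENNReal.ofReal (N.f i (x.queue i)) else 0) * h (N.activate x i)
      + (if i ∈ x.active then ENNReal.ofReal (N.mu i - N.g i (x.queue i)) else 0)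
          * h (N.continueServing x i)
      + (if i ∈ x.active then ENNReal.ofReal (N.g i (x.queue i)) else 0)
          * h (N.release x i)) := by
  have key : ∀ y, ENNReal.ofReal (N.rate x y) * h y = ∑ i,
      ((if y = N.arrive x i then ENNReal.ofReal (N.arr i) * h (N.arrive x i) else 0)
      + (if y = N.activate x i then (if N.Unblocked x i then
          ENNReal.ofReal (N.f i (x.queue i)) else 0) * h (N.activate x i) else 0)
      + (if y = N.continueServing x i then (if i ∈ x.active then
          ENNReal.ofReal (N.mu i - N.g i (x.queue i)) else 0) * h (N.continueServing x i) else 0)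
      + (if y = N.release x i then (if i ∈ x.active then
          ENNReal.ofReal (N.g i (x.queue i)) else 0) * h (N.release x i) else 0)) := by
    intro y
    have e : ∀ (a : ℝ≥0∞) (z : N.State),
        (if y = z then a * h z else 0) = (if y = z then a else 0) * h y := by
      intro a z
      split_ifs with hz
      · rw [hz]
      · simp
    simp only [e, ← add_mul, ← Finset.sum_mul]
    by_cases hxy : x = y
    · rw [← hxy, hx, mul_zero, mul_zero]
    · rw [N.ofReal_rate hxy]
  simp_rw [key]
  rw [Summable.tsum_finsetSum fun _ _ => ENNReal.summable]
  simp only [ENNReal.tsum_add, tsum_ite_eq]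

/-- A bound on the total rate out of any state. -/
noncomputable def rateBound : ℝ≥0∞ :=
  ∑ i, (ENNReal.ofReal (N.arr i) + ENNReal.ofReal (N.nu i)
    + ENNReal.ofReal (N.mu i) + ENNReal.ofReal (N.mu i))

lemma rateBound_lt_top : N.rateBound < ∞ :=
  ENNReal.sum_lt_top.2 fun i _ => by simp

lemma exitRate_le (x : N.State) : N.exitRate x ≤ N.rateBound := by
  classical
  -- The weight vanishes at `x`, as `tsum_rate_mul` requires.
  have h : N.exitRate x = ∑' y, ENNReal.ofReal (N.rate x y) * (if y = x then 0 else 1) := by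
    refine tsum_congr fun y => ?_
    by_cases hy : y = x
    · simp [hy, rate]
    · simp [hy]
  rw [h, N.tsum_rate_mul x _ (by simp)]
  refine Finset.sum_le_sum fun i _ => ?_
  have one : ∀ y : N.State, (if y = x then (0 : ℝ≥0∞) else 1) ≤ 1 := fun y => by
    split_ifs <;> simp
  refine add_le_add (add_le_add (add_le_add ?_ ?_) ?_) ?_ <;>
    refine (mul_le_of_le_one_right' (one _)).trans ?_
  · exact le_rfl
  · split_ifs
    · exact ENNReal.ofReal_le_ofReal (N.f_le i _)
    · exact zero_le
  · split_ifs
    · exact ENNReal.ofReal_le_ofReal (sub_le_self _ (N.g_nonneg i _))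
    · exact zero_le
  · split_ifs
    · exact ENNReal.ofReal_le_ofReal (N.g_le i _)
    · exact zero_le

lemma exitRate_ne_top (x : N.State) : N.exitRate x ≠ ∞ :=
  ((N.exitRate_le x).trans_lt N.rateBound_lt_top).ne

/-- Arrivals are always possible, so no state is absorbing and exit rates can be inverted. -/
lemma rate_arrive_pos (x : N.State) (i : V) :
    0 < ENNReal.ofReal (N.rate x (N.arrive x i)) := by
  classical
  have hne : x ≠ N.arrive x i := fun h => by
    have := congrFun (congrArg State.queue h) i
    simp [arrive] at this
  rw [N.ofReal_rate hne]
  refine lt_of_lt_of_le ?_ (Finset.single_le_sum (fun _ _ => zero_le) (Finset.mem_univ i))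
  simp [N.arr_pos i]

lemma exitRate_ne_zero [Nonempty V] (x : N.State) : N.exitRate x ≠ 0 :=
  ((N.rate_arrive_pos x (Classical.arbitrary V)).trans_le
    (ENNReal.le_tsum (f := fun y => ENNReal.ofReal (N.rate x y)) _)).ne'

/-! ### Existence of a stationary distribution. -/

/-- Expected number of visits to `y` during a cycle of the jump chain from `z` back to `z`. -/
noncomputable def cycleVisits (z y : N.State) : ℝ≥0∞ := ∑' n, N.avoid z z n y

lemma cycleVisits_self (z : N.State) : N.cycleVisits z z = 1 := by
  rw [cycleVisits, tsum_eq_single 0]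
  · simp [avoid]
  · rintro (_ | n) hn
    · exact absurd rfl hn
    · simp [avoid]

/-- One further jump shifts the recursion for `avoid` by one. Away from `z` the lost term `n = 0` is
zero; at `z` the sum is the return probability. -/
lemma tsum_cycleVisits_mul_jumpProb {z : N.State} (hz : N.hitProb z z = 1) (y : N.State) :
    ∑' x, N.cycleVisits z x * N.jumpProb x y = N.cycleVisits z y := by
  simp_rw [cycleVisits, ← ENNReal.tsum_mul_right]
  rw [ENNReal.tsum_comm]
  by_cases hy : y = z
  · subst hy
    exact hz.trans (N.cycleVisits_self y).symm
  · rw [tsum_eq_zero_add' (f := fun n => N.avoid z z n y) ENNReal.summable]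
    simp [avoid, hy]

/-- The weight `w y` is the expected time spent in `y` per cycle, with total mass the mean return
time. Multiplying by the exit rate turns time into visits, which are invariant under the jump chain.
-/
theorem exists_isStationary [Nonempty V] (hN : N.IsStable) :
    ∃ π : PMF N.State, N.IsStationary π := by
  obtain ⟨z, hz, ht⟩ := hN
  set w : N.State → ℝ≥0∞ := fun y => N.cycleVisits z y * (N.exitRate y)⁻¹ with hw
  have hsum : ∑' y, w y = N.meanReturnTime z := by
    simp_rw [hw, cycleVisits, ← ENNReal.tsum_mul_right]
    exact ENNReal.tsum_comm
  have hzero : ∑' y, w y ≠ 0 := by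
    refine (lt_of_lt_of_le ?_ (ENNReal.le_tsum z)).ne'
    simp [hw, N.cycleVisits_self, N.exitRate_ne_top z]
  have htop : ∑' y, w y ≠ ∞ := hsum ▸ ht
  refine ⟨PMF.normalize w hzero htop, fun y => ?_⟩
  simp only [PMF.normalize_apply]
  set c := (∑' y, w y)⁻¹
  have e1 : ∀ x, w x * c * ENNReal.ofReal (N.rate x y)
      = c * (N.cycleVisits z x * N.jumpProb x y) := fun x => by
    rw [hw, jumpProb, ENNReal.div_eq_inv_mul]
    ring
  simp_rw [e1]
  rw [ENNReal.tsum_mul_left, N.tsum_cycleVisits_mul_jumpProb (hz z)]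
  have := ENNReal.inv_mul_cancel (N.exitRate_ne_zero y) (N.exitRate_ne_top y)
  calc c * N.cycleVisits z y
      = c * N.cycleVisits z y * ((N.exitRate y)⁻¹ * N.exitRate y) := by rw [this, mul_one]
    _ = w y * c * N.exitRate y := by rw [hw]; ring

/-! ### Balance across cuts. -/

variable {N} {π : PMF N.State}

lemma tsum_mul_exitRate_ne_top (π : PMF N.State) (A : Set N.State) :
    ∑' x, A.indicator π x * N.exitRate x ≠ ∞ := by
  refine ((ENNReal.tsum_le_tsum fun x => mul_le_mul' (Set.indicator_le_self' (fun _ _ => zero_le) x)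
    (N.exitRate_le x)).trans_lt ?_).ne
  rw [ENNReal.tsum_mul_right, π.tsum_coe, one_mul]
  exact N.rateBound_lt_top

/-- In steady state the probability flow out of a set of states equals the flow into it. -/
lemma IsStationary.cut (hπ : N.IsStationary π) (A : Set N.State) :
    ∑' x, A.indicator π x * ∑' y, ENNReal.ofReal (N.rate x y) * Aᶜ.indicator 1 y
      = ∑' x, Aᶜ.indicator π x * ∑' y, ENNReal.ofReal (N.rate x y) * A.indicator 1 y := by
  -- The flow inside `A`. Adding it to either side gives the total flow out of the states of `A`; it
  -- is finite, hence cancels.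
  set S : ℝ≥0∞ := ∑' x, A.indicator π x * ∑' y, ENNReal.ofReal (N.rate x y) * A.indicator 1 y
    with hS
  have hout : S + ∑' x, A.indicator π x * ∑' y, ENNReal.ofReal (N.rate x y) * Aᶜ.indicator 1 y
      = ∑' x, A.indicator π x * N.exitRate x := by
    rw [hS, ← ENNReal.tsum_add]
    refine tsum_congr fun x => ?_
    rw [← mul_add, ← ENNReal.tsum_add, exitRate]
    congr 1
    refine tsum_congr fun y => ?_
    rw [← mul_add]
    by_cases hy : y ∈ A <;> simp [hy]
  have hin : S + ∑' x, Aᶜ.indicator π x * ∑' y, ENNReal.ofReal (N.rate x y) * A.indicator 1 y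
      = ∑' x, A.indicator π x * N.exitRate x := by
    rw [hS, ← ENNReal.tsum_add]
    have e : ∀ x, A.indicator π x * N.exitRate x
        = ∑' y, π y * ENNReal.ofReal (N.rate y x) * A.indicator 1 x := fun x => by
      rw [ENNReal.tsum_mul_right, hπ x]
      by_cases hx : x ∈ A <;> simp [hx]
    simp_rw [e]
    rw [ENNReal.tsum_comm]
    refine tsum_congr fun x => ?_
    rw [← add_mul, ← ENNReal.tsum_mul_left]
    refine tsum_congr fun y => ?_
    by_cases hx : x ∈ A <;> simp [hx, mul_assoc]
  have hfin : S ≠ ∞ := by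
    refine ne_top_of_le_ne_top (tsum_mul_exitRate_ne_top π A) ?_
    rw [← hout]
    exact le_self_add
  exact (ENNReal.add_right_inj hfin).1 (hout.trans hin.symm)

lemma arrive_queue (x : N.State) (i j : V) :
    (N.arrive x i).queue j = if j = i then x.queue j + 1 else x.queue j := by
  simp only [arrive, Function.update_apply]
  split_ifs with h <;> simp [h]

lemma activate_queue (x : N.State) (i : V) : (N.activate x i).queue = x.queue := by
  unfold activate
  split_ifs <;> rfl

lemma continueServing_queue (x : N.State) (i j : V) :
    (N.continueServing x i).queue j = if j = i then x.queue j - 1 else x.queue j := by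
  simp only [continueServing, Function.update_apply]
  split_ifs with h <;> simp [h]

lemma release_queue (x : N.State) (i j : V) :
    (N.release x i).queue j = if j = i then x.queue j - 1 else x.queue j := by
  simp only [release, Function.update_apply]
  split_ifs with h <;> simp [h]

lemma IsStationary.level_crossing (hπ : N.IsStationary π) (j : V) (n : ℕ) :
    ENNReal.ofReal (N.arr j) * π.toMeasure {x | x.queue j = n}
      = ENNReal.ofReal (N.mu j) * π.toMeasure {x | x.queue j = n + 1 ∧ j ∈ x.active} := by
  classical
  have hcut := hπ.cut {x | x.queue j ≤ n}
  rw [PMF.toMeasure_apply _ (MeasurableSet.of_discrete), PMF.toMeasure_apply _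
    (MeasurableSet.of_discrete), ← ENNReal.tsum_mul_left, ← ENNReal.tsum_mul_left]
  convert hcut using 3 with x x
  · by_cases hx : x.queue j ≤ n
    · rw [N.tsum_rate_mul x _ (by simpa using hx), Finset.sum_eq_single j]
      · simp only [Set.indicator_apply, Set.mem_compl_iff, Set.mem_ofPred_eq, arrive_queue,
          activate_queue, continueServing_queue, release_queue, Pi.one_apply]
        have h1 : x.queue j - 1 ≤ n := by omega
        by_cases h : x.queue j = n
        · simp [h, mul_comm]
        · have h2 : x.queue j + 1 ≤ n := by omega
          simp [h, h1, h2, hx]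
      · intro i _ hij
        simp [arrive_queue, activate_queue, continueServing_queue,
          release_queue, hx, hij.symm]
      · simp
    · have h : x.queue j ≠ n := by omega
      simp [Set.indicator_apply, hx, h]
  · by_cases hx : x.queue j ≤ n
    · have h : x.queue j ≠ n + 1 := by omega
      simp [Set.indicator_apply, hx, h]
    · rw [N.tsum_rate_mul x _ (by simpa using hx), Finset.sum_eq_single j]
      · simp only [Set.indicator_apply, Set.mem_compl_iff, Set.mem_ofPred_eq, arrive_queue,
          activate_queue, continueServing_queue, release_queue, Pi.one_apply]
        have h1 : ¬ x.queue j + 1 ≤ n := by omega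
        by_cases h : x.queue j = n + 1
        · by_cases ha : j ∈ x.active
          · simp only [h, ha]
            -- Both kinds of completion lower the queue; their rates add up to `mu j`.
            simp [← ENNReal.ofReal_add (sub_nonneg.2 (N.g_le j _)) (N.g_nonneg j _), mul_comm]
          · simp [h, ha]
        · have h2 : ¬ x.queue j - 1 ≤ n := by omega
          simp [h, h1, h2, hx]
      · intro i _ hij
        simp [arrive_queue, activate_queue, continueServing_queue,
          release_queue, hx, hij.symm]
      · simp

lemma mem_activate (x : N.State) (i j : V) :
    j ∈ (N.activate x i).active ↔ j ∈ x.active ∨ (j = i ∧ N.Unblocked x i) := by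
  unfold activate
  split_ifs with h <;> simp [h, or_comm]

lemma IsStationary.lintegral_activation (hπ : N.IsStationary π) (i : V) :
    ∫⁻ x in {x | N.Unblocked x i}, ENNReal.ofReal (N.f i (x.queue i)) ∂π.toMeasure
      = ∫⁻ x in {x | i ∈ x.active}, ENNReal.ofReal (N.g i (x.queue i)) ∂π.toMeasure := by
  classical
  have hcut := hπ.cut {x | i ∉ x.active}
  rw [← lintegral_indicator MeasurableSet.of_discrete,
    ← lintegral_indicator MeasurableSet.of_discrete, lintegral_countable', lintegral_countable']
  simp only [PMF.toMeasure_apply_singleton _ _ (MeasurableSet.singleton _)]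
  convert hcut using 3 with x x
  · by_cases hx : i ∈ x.active
    · have h : ¬ N.Unblocked x i := fun h => h.1 hx
      simp [Set.indicator_apply, hx, h]
    · rw [N.tsum_rate_mul x _ (by simpa using hx), Finset.sum_eq_single i]
      · simp only [Set.indicator_apply, Set.mem_compl_iff, Set.mem_ofPred_eq, not_not,
          mem_activate, Pi.one_apply]
        by_cases h : N.Unblocked x i
        · simp [h, hx, arrive, mul_comm]
        · simp [h, hx, arrive]
      · intro j _ hij
        simp [mem_activate, arrive, continueServing, release, hx, hij.symm]
      · simp
  · by_cases hx : i ∈ x.active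
    · rw [N.tsum_rate_mul x _ (by simpa using hx), Finset.sum_eq_single i]
      · simp [mem_activate, arrive, continueServing, release, hx, mul_comm]
      · intro j _ hij
        simp [mem_activate, arrive, continueServing, release, hx, hij.symm]
      · simp
    · simp [Set.indicator_apply, hx]

/-! ### Summing the level crossings. -/

lemma lintegral_queue (m : Measure N.State) (i : V) (F : ℕ → ℝ≥0∞) :
    ∫⁻ x, F (x.queue i) ∂m = ∑' n, F n * m {x | x.queue i = n} := by
  have hq : Measurable fun x : N.State => x.queue i := measurable_of_countable _
  rw [← lintegral_map (f := F) (measurable_of_countable _) hq, lintegral_countable']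
  refine tsum_congr fun n => ?_
  rw [Measure.map_apply hq (measurableSet_singleton n)]
  rfl

lemma setLIntegral_active_queue (m : Measure N.State) (i : V) (F : ℕ → ℝ≥0∞) :
    ∫⁻ x in {x | i ∈ x.active}, F (x.queue i) ∂m
      = ∑' n, F n * m {x | x.queue i = n ∧ i ∈ x.active} := by
  rw [lintegral_queue]
  refine tsum_congr fun n => ?_
  rw [Measure.restrict_apply MeasurableSet.of_discrete]
  rfl

/-- Level crossing at `n`, weighted by `F (n + 1)` and summed. The term of the right side at queue
length 0, a dummy transmission, has no counterpart and is dropped. -/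
lemma IsStationary.arr_mul_lintegral_le (hπ : N.IsStationary π) (i : V) (F : ℕ → ℝ≥0∞) :
    ENNReal.ofReal (N.arr i) * ∫⁻ x, F (x.queue i + 1) ∂π.toMeasure
      ≤ ENNReal.ofReal (N.mu i) * ∫⁻ x in {x | i ∈ x.active}, F (x.queue i) ∂π.toMeasure := by
  rw [setLIntegral_active_queue, lintegral_queue π.toMeasure i fun n => F (n + 1),
    ← ENNReal.tsum_mul_left, ← ENNReal.tsum_mul_left,
    tsum_eq_zero_add' (f := fun n => ENNReal.ofReal (N.mu i) * (F n * _)) ENNReal.summable]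
  refine le_add_left (le_of_eq (tsum_congr fun n => ?_))
  rw [mul_left_comm, hπ.level_crossing, mul_left_comm]

lemma IsStationary.arr_eq (hπ : N.IsStationary π) (i : V) :
    ENNReal.ofReal (N.arr i)
      = ENNReal.ofReal (N.mu i) * π.toMeasure {x | x.queue i ≠ 0 ∧ i ∈ x.active} := by
  have h1 : π.toMeasure {x | x.queue i ≠ 0 ∧ i ∈ x.active}
      = ∑' n, π.toMeasure {x | x.queue i = n + 1 ∧ i ∈ x.active} := by
    rw [← measure_iUnion _ fun _ => MeasurableSet.of_discrete]
    · congr 1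
      ext x
      simp [Nat.exists_eq_add_one, Nat.pos_iff_ne_zero]
    · intro a b hab
      refine Set.disjoint_left.2 fun x hx hx' => hab ?_
      have := hx.1.symm.trans hx'.1
      omega
  have h2 := lintegral_queue π.toMeasure i fun _ => 1
  simp only [lintegral_one, measure_univ, one_mul] at h2
  rw [h1, ← ENNReal.tsum_mul_left, ← tsum_congr fun n => hπ.level_crossing i n,
    ENNReal.tsum_mul_left, ← h2, mul_one]

lemma IsStationary.rho_eq (hπ : N.IsStationary π) (i : V) :
    N.rho i = π.toMeasure.real {x | x.queue i ≠ 0 ∧ i ∈ x.active} := by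
  have h := congrArg ENNReal.toReal (hπ.arr_eq i)
  rw [ENNReal.toReal_mul, ENNReal.toReal_ofReal (N.arr_pos i).le,
    ENNReal.toReal_ofReal (N.mu_pos i).le] at h
  rw [rho, h, mul_div_cancel_left₀ _ (N.mu_pos i).ne']
  rfl

/-- A null state has zero inflow by global balance, so the support is closed under possible jumps.
-/
lemma IsStationary.ne_zero_of_rate (hπ : N.IsStationary π) {x y : N.State} (hx : π x ≠ 0)
    (h : ENNReal.ofReal (N.rate x y) ≠ 0) : π y ≠ 0 := by
  intro hy
  have := hπ y
  rw [hy, zero_mul, ENNReal.tsum_eq_zero] at this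
  exact (mul_ne_zero hx h) (this x)

lemma rate_release_ne_zero {x : N.State} {i : V} (hi : i ∈ x.active)
    (hg : 0 < N.g i (x.queue i)) : ENNReal.ofReal (N.rate x (N.release x i)) ≠ 0 := by
  classical
  have hne : x ≠ N.release x i := fun h => by
    have : i ∈ (N.release x i).active := h ▸ hi
    simp [release] at this
  rw [N.ofReal_rate hne]
  refine (lt_of_lt_of_le ?_ (Finset.single_le_sum (fun _ _ => zero_le) (Finset.mem_univ i))).ne'
  simp [hi, hg]

lemma rate_continueServing_ne_zero {x : N.State} {i : V} (hi : i ∈ x.active)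
    (hq : x.queue i ≠ 0) (hg : N.g i (x.queue i) < N.mu i) :
    ENNReal.ofReal (N.rate x (N.continueServing x i)) ≠ 0 := by
  classical
  have hne : x ≠ N.continueServing x i := fun h => by
    have := congrFun (congrArg State.queue h) i
    rw [continueServing_queue, if_pos rfl] at this
    omega
  rw [N.ofReal_rate hne]
  refine (lt_of_lt_of_le ?_ (Finset.single_le_sum (fun _ _ => zero_le) (Finset.mem_univ i))).ne'
  simp [hi, hg]

/-! ### The load of a clique. -/

lemma State.eq_of_mem_clique {C : Finset V} (hC : N.graph.IsClique (C : Set V)) (x : N.State)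
    {i j : V} (hi : i ∈ C) (hj : j ∈ C) (hia : i ∈ x.active) (hja : j ∈ x.active) : i = j := by
  by_contra hij
  exact x.feasible hia hja hij (hC hi hj hij)

/-- The states in which no node of `C` transmits a genuine packet. -/
def noService (N : Network V) (C : Finset V) : Set N.State :=
  {x | ∀ j ∈ C, ¬ (x.queue j ≠ 0 ∧ j ∈ x.active)}

/-- Makes ρ_C < 1 strict. From a state of the support, completions at the one active node of `C`
lead either to a release or to an empty queue, without leaving the support. -/
lemma IsStationary.exists_mem_noService (hπ : N.IsStationary π) {C : Finset V}
    (hC : N.graph.IsClique (C : Set V)) : ∃ x ∈ noService N C, π x ≠ 0 := by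
  have hserving : ∀ n, ∀ x : N.State, π x ≠ 0 → ∀ j ∈ C, j ∈ x.active → x.queue j = n →
      ∃ x ∈ noService N C, π x ≠ 0 := by
    intro n
    induction n with
    | zero =>
      intro x hx j hj hja hq
      refine ⟨x, fun k hk hk' => hk'.1 ?_, hx⟩
      rw [← x.eq_of_mem_clique hC hj hk hja hk'.2, hq]
    | succ n ih =>
      intro x hx j hj hja hq
      by_cases hg : 0 < N.g j (x.queue j)
      · refine ⟨N.release x j, fun k hk hk' => ?_, hπ.ne_zero_of_rate hx
          (rate_release_ne_zero hja hg)⟩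
        have h := Finset.mem_erase.1 hk'.2
        exact h.1 (x.eq_of_mem_clique hC hk hj h.2 hja)
      -- Here the release rate is zero, so every completion is followed by another transmission.
      · refine ih (N.continueServing x j) (hπ.ne_zero_of_rate hx (rate_continueServing_ne_zero hja
          (by omega) ((not_lt.1 hg).trans_lt (N.mu_pos j)))) j hj hja ?_
        rw [continueServing_queue, if_pos rfl, hq]
        rfl
  obtain ⟨x, hx⟩ := π.support_nonempty
  by_cases h : x ∈ noService N C
  · exact ⟨x, h, hx⟩
  · simp only [noService, Set.mem_ofPred_eq, not_forall, not_not] at h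
    obtain ⟨j, hj, -, hja⟩ := h
    exact hserving _ x hx j hj hja rfl

lemma IsStationary.load_add_noService (hπ : N.IsStationary π) {C : Finset V}
    (hC : N.graph.IsClique (C : Set V)) :
    N.load C + π.toMeasure.real (noService N C) = 1 := by
  have hU : (⋃ j ∈ C, {x : N.State | x.queue j ≠ 0 ∧ j ∈ x.active}) = (noService N C)ᶜ := by
    ext x
    simp only [noService, Set.mem_iUnion, Set.mem_compl_iff, Set.mem_ofPred_eq, not_forall, not_not,
      exists_prop]
  have : N.load C = π.toMeasure.real (noService N C)ᶜ := by
    rw [← hU, measureReal_biUnion_finset _ fun _ _ => MeasurableSet.of_discrete]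
    · exact Finset.sum_congr rfl fun j _ => hπ.rho_eq j
    · intro j hj k hk hjk
      exact Set.disjoint_left.2 fun x hx hx' =>
        hjk (x.eq_of_mem_clique hC hj hk hx.2 hx'.2)
  rw [this, add_comm, measureReal_add_measureReal_compl MeasurableSet.of_discrete, probReal_univ]

lemma IsStationary.load_lt_one (hπ : N.IsStationary π) {C : Finset V}
    (hC : N.graph.IsClique (C : Set V)) : N.load C < 1 := by
  obtain ⟨x, hxs, hx⟩ := hπ.exists_mem_noService hC
  have hpos : 0 < π.toMeasure.real (noService N C) := by
    refine ENNReal.toReal_pos (fun h => hx ?_) (measure_ne_top _ _)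
    rw [← π.toMeasure_apply_singleton x (MeasurableSet.singleton x)]
    exact measure_mono_null (Set.singleton_subset_iff.2 hxs) h
  linarith [hπ.load_add_noService hC]

lemma IsStationary.idle_le (hπ : N.IsStationary π) {C : Finset V}
    (hC : N.graph.IsClique (C : Set V)) : π.toMeasure.real (N.idle C) ≤ 1 - N.load C := by
  have : N.idle C ⊆ noService N C := fun x hx j hj h => hx j hj h.2
  linarith [hπ.load_add_noService hC, measureReal_mono (μ := π.toMeasure) this]

/-! ### The bound at a node of a clique. -/

lemma integrable_of_bounded (m : Measure N.State) [IsFiniteMeasure m] {F : N.State → ℝ} {B : ℝ}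
    (h0 : ∀ x, 0 ≤ F x) (hB : ∀ x, F x ≤ B) : Integrable F m :=
  Integrable.of_bound (measurable_of_countable F).aestronglyMeasurable B
    (ae_of_all _ fun x => by rw [Real.norm_of_nonneg (h0 x)]; exact hB x)

lemma unblocked_subset_idle (N : Network V) {C : Finset V} (hC : N.graph.IsClique (C : Set V))
    {i : V} (hi : i ∈ C) : {x | N.Unblocked x i} ⊆ N.idle C := by
  intro x hx j hj
  by_cases hij : i = j
  · exact hij ▸ hx.1
  · exact hx.2 j (hC hi hj hij)

/-- Kept undivided, so that it also applies when `idle C` is null and can be used to rule that case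
out. -/
lemma IsStationary.rho_mul_expQueue_le (hπ : N.IsStationary π) {C : Finset V}
    (hC : N.graph.IsClique (C : Set V)) {i : V} (hi : i ∈ C) :
    N.rho i * N.expQueue π i (fun n => N.g i (n + 1))
      ≤ ∫ x in N.idle C, N.f i (x.queue i) ∂π.toMeasure := by
  have hG : ENNReal.ofReal (N.expQueue π i (fun n => N.g i (n + 1)))
      = ∫⁻ x, ENNReal.ofReal (N.g i (x.queue i + 1)) ∂π.toMeasure :=
    ofReal_integral_eq_lintegral_ofReal
      (integrable_of_bounded _ (fun _ => N.g_nonneg i _) fun _ => N.g_le i _)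
      (ae_of_all _ fun _ => N.g_nonneg i _)
  have hF : ENNReal.ofReal (∫ x in N.idle C, N.f i (x.queue i) ∂π.toMeasure)
      = ∫⁻ x in N.idle C, ENNReal.ofReal (N.f i (x.queue i)) ∂π.toMeasure :=
    ofReal_integral_eq_lintegral_ofReal
      (integrable_of_bounded _ (fun _ => N.f_nonneg i _) fun _ => N.f_le i _)
      (ae_of_all _ fun _ => N.f_nonneg i _)
  have hF0 : 0 ≤ ∫ x in N.idle C, N.f i (x.queue i) ∂π.toMeasure :=
    integral_nonneg fun _ => N.f_nonneg i _
  have h := hπ.arr_mul_lintegral_le i fun n => ENNReal.ofReal (N.g i n)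
  rw [← hG, ← hπ.lintegral_activation i] at h
  replace h := h.trans (mul_le_mul_right
    (lintegral_mono_set (N.unblocked_subset_idle hC hi)) _)
  rw [← hF, ← ENNReal.ofReal_mul (N.arr_pos i).le, ← ENNReal.ofReal_mul (N.mu_pos i).le,
    ENNReal.ofReal_le_ofReal_iff (mul_nonneg (N.mu_pos i).le hF0)] at h
  rw [rho, div_mul_eq_mul_div, div_le_iff₀' (N.mu_pos i)]
  exact h

lemma expQueueIdle_eq (π : PMF N.State) (i : V) (C : Finset V) (F : ℕ → ℝ) :
    N.expQueueIdle π i C F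
      = (∫ x in N.idle C, F (x.queue i) ∂π.toMeasure) / π.toMeasure.real (N.idle C) := by
  rw [expQueueIdle, ProbabilityTheory.cond, integral_smul_measure, ENNReal.toReal_inv, smul_eq_mul,
    div_eq_inv_mul]
  rfl

/-- Lower bound on the ratio of activation and de-activation rates at a node of a clique. -/
lemma IsStationary.clique_bound (hπ : N.IsStationary π) {C : Finset V}
    (hC : N.graph.IsClique (C : Set V)) {i : V} (hi : i ∈ C)
    (hG : 0 < N.expQueue π i (fun n => N.g i (n + 1))) :
    0 < π.toMeasure (N.idle C) ∧ N.rho i / (1 - N.load C) ≤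
      N.expQueueIdle π i C (N.f i) / N.expQueue π i (fun n => N.g i (n + 1)) := by
  have h := hπ.rho_mul_expQueue_le hC hi
  have hpos : 0 < π.toMeasure (N.idle C) := by
    refine pos_iff_ne_zero.2 fun h0 => ?_
    rw [Measure.restrict_eq_zero.2 h0, integral_zero_measure] at h
    exact absurd h (not_le.2 (mul_pos (N.rho_pos i) hG))
  have hreal : 0 < π.toMeasure.real (N.idle C) := ENNReal.toReal_pos hpos.ne' (measure_ne_top _ _)
  -- By `idle_le`, replacing `1 - load C` by the positive probability of `idle C` only increases the
  -- quotient.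
  refine ⟨hpos, (div_le_div_of_nonneg_left (N.rho_pos i).le hreal (hπ.idle_le hC)).trans ?_⟩
  rw [expQueueIdle_eq, div_div, mul_comm, div_mul_eq_div_div, div_le_div_iff_of_pos_right hreal,
    le_div_iff₀ hG]
  exact h

end Dynamics

end Network

theorem lemma1 {V : Type*} [Fintype V] [DecidableEq V] (N : Network V) (hN : N.IsStable)
    (C : Finset V) (hC : N.graph.IsClique (C : Set V)) (i : V) (hi : i ∈ C) :
    (∃ π : PMF N.State, N.IsStationary π) ∧
    ∀ π : PMF N.State, N.IsStationary π →
      N.load C < 1 ∧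
      (0 < N.expQueue π i (fun n => N.g i (n + 1)) →
        0 < π.toMeasure (N.idle C) ∧
        N.rho i / (1 - N.load C) ≤
          N.expQueueIdle π i C (N.f i) / N.expQueue π i (fun n => N.g i (n + 1))) ∧
      (∀ a b : ℝ, (∀ n, N.phi i n = a) → (∀ n, N.psi i n = b) → 0 < b →
        N.rho i / (1 - N.load C) ≤ (N.nu i * a) / (N.mu i * b)) := by
  have : Nonempty V := ⟨i⟩
  refine ⟨N.exists_isStationary hN, fun π hπ => ⟨hπ.load_lt_one hC, hπ.clique_bound hC hi, ?_⟩⟩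
  intro a b ha hb hb0
  have hg : N.expQueue π i (fun n => N.g i (n + 1)) = N.mu i * b := by
    simp [Network.expQueue, Network.g, hb]
  obtain ⟨hpos, h⟩ := hπ.clique_bound hC hi (hg ▸ mul_pos (N.mu_pos i) hb0)
  -- With total mass one, the conditional mean of a constant is that constant.
  have := ProbabilityTheory.cond_isProbabilityMeasure hpos.ne'
  have hf : N.expQueueIdle π i C (N.f i) = N.nu i * a := by
    simp [Network.expQueueIdle, Network.f, ha]
  rwa [hg, hf] at h
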